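/- **Setting.** Let $k\ge 1$ and let $X_\theta\sim\mathcal N\big((\mu_1,\dots,\mu_k),\operatorname{diag}(\sigma_1^2,\dots,\sigma_k^2)\big)$ with parameter $\theta=(\mu_1,\dots,\mu_k,\sigma_1,\dots,\sigma_k)$, $\sigma_j\ge 0$. The secrets $g_1(\theta),\dots,g_d(\theta)$ are $d$ distinct coordinates of $\theta$ (so $d\le 2k$), with tolerances $\epsilon_i>0$. Let $\theta$ be random with prior law $P$. A release mechanism $\mathcal M$ is a Markov kernel $\theta\mapsto\theta'\sim\mathcal M(\theta)$ on the parameters. Its intersection privacy is $$\Pi^{\mathrm{inter}}(\mathcal M)=\sup_{\hat g}\ \mathbb P\Big(\bigcap_{i=1}^d\big\{|\hat g_i(\theta')-g_i(\theta)|\le\epsilon_i\big\}\Big),$$ where the supremum is over all (possibly randomized) attacker strategies $\hat g=(\hat g_1,\dots,\hat g_d)$ depending on the released $\theta'$ only, and the probability is over $\theta\sim P$, $\mathcal M$ and $\hat g$. Its distortion is $$\Delta_{\mathcal M}=\sup_{\theta\in\operatorname{supp}P,\ \theta'\in\operatorname{supp}\mathcal M(\theta)}W_2\big(\mathrm{Law}(X_\theta),\mathrm{Law}(X_{\theta'})\big),$$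 with $W_2$ the Wasserstein-2 distance. For a budget $T$, let $\Delta_{opt}(T)=\inf\{\Delta_{\mathcal M}:\Pi^{\mathrm{inter}}(\mathcal M)\le T\}$. **Mechanism.** Given lower bounds $\underline{g_i}$ of the secrets and interval lengths $s_{g_i}$, the quantization mechanism $\mathcal M_{\mathrm{Alg.1}}$ releases, for each $i$, $g_i'(\theta)=\underline{g_i}+\big\lfloor (g_i(\theta)-\underline{g_i})/s_{g_i}\big\rfloor s_{g_i}+U_i$ in place of $g_i(\theta)$, with independent $U_i$ uniform on $(0,s_{g_i})$, and leaves the non-secret parameters unchanged. **Proposition.** Let $s_{g_i}\ge 2\epsilon_i>0$ for $i=1,\dots,d$. There is a constant $c_{\epsilon,s}>0$ depending only on $(\epsilon_i)_i$ and $(s_{g_i})_i$ such that the following holds for every $k$, every choice of secrets and every prior $P$ for which the secret parameters are mutually independent, jointly independent of the non-secret parameters, and each $g_i(\theta)$ is uniform on $[\underline{g_i},\underline{g_i}+N_is_{g_i}]$ for some integer $N_i\ge1$: $$\Pi^{\mathrm{inter}}(\mathcal M_{\mathrm{Alg.1}})=\prod_{i=1}^d\frac{2\epsilon_i}{s_{g_i}},\qquad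 \Delta_{\mathcal M_{\mathrm{Alg.1}}}=\sqrt{\sum_{i=1}^d s_{g_i}^2},$$ and, if moreover $\prod_{i=1}^d 2\epsilon_i/s_{g_i}<1$, $$\Delta_{\mathcal M_{\mathrm{Alg.1}}}<c_{\epsilon,s}\cdot\Delta_{opt}\big(\Pi^{\mathrm{inter}}(\mathcal M_{\mathrm{Alg.1}})\big).$$ -/

import Mathlib

open MeasureTheory ProbabilityTheory
open scoped ENNReal

namespace SummaryPrivacy

/-- Parameters `θ = (μ₁, …, μₖ, σ₁, …, σₖ)` of a `k`-dimensional Gaussian with independent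
coordinates: `θ (Sum.inl j)` is the mean `μⱼ` and `θ (Sum.inr j)` the standard deviation `σⱼ`. -/
abbrev Param (k : ℕ) : Type := Fin k ⊕ Fin k → ℝ

/-- The data distribution with parameter `θ`: the Gaussian on `ℝᵏ` with mean `(μ₁, …, μₖ)` and
covariance matrix `diag(σ₁², …, σₖ²)`. -/
noncomputable def gaussianLaw {k : ℕ} (θ : Param k) : Measure (EuclideanSpace ℝ (Fin k)) :=
  multivariateGaussian (WithLp.toLp 2 fun j => θ (Sum.inl j))
    (Matrix.diagonal fun j => θ (Sum.inr j) ^ 2)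

/-- The Wasserstein-2 distance: the square root of the infimum of `∫ d(x, y)² dπ(x, y)` over all
couplings `π` of `μ` and `ν`. -/
noncomputable def wasserstein2 {E : Type*} [PseudoEMetricSpace E] [MeasurableSpace E]
    (μ ν : Measure E) : ℝ≥0∞ :=
  (⨅ (π : Measure (E × E)) (_ : π.map Prod.fst = μ ∧ π.map Prod.snd = ν),
    ∫⁻ z, edist z.1 z.2 ^ 2 ∂π) ^ (1 / 2 : ℝ)

/-- Intersection privacy of a release mechanism `M` under the prior `P`, for the secrets
`gᵢ(θ) = θ (g i)` and the tolerances `ε i`: the supremum, over all (possibly randomized) attacker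
strategies `A`, of the probability that the guess made from the released parameter `θ'` is within
`ε i` of `gᵢ(θ)` for all `i` at once. A sample point is `((θ, θ'), guess)`. -/
noncomputable def interPrivacy {k d : ℕ} (P : Measure (Param k)) (g : Fin d ↪ Fin k ⊕ Fin k)
    (ε : Fin d → ℝ) (M : Kernel (Param k) (Param k)) : ℝ≥0∞ :=
  ⨆ (A : Kernel (Param k) (Fin d → ℝ)) (_ : IsMarkovKernel A),
    ((P ⊗ₘ M) ⊗ₘ A.prodMkLeft (Param k)) {z | ∀ i, |z.2 i - z.1.1 (g i)| ≤ ε i}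

/-- Distortion of a release mechanism `M` under the prior `P`: the worst-case Wasserstein-2
distance between the original and the released data distribution. -/
noncomputable def distortion {k : ℕ} (P : Measure (Param k)) (M : Kernel (Param k) (Param k)) :
    ℝ≥0∞ :=
  ⨆ θ ∈ P.support, ⨆ θ' ∈ (M θ).support, wasserstein2 (gaussianLaw θ) (gaussianLaw θ')

/-- The optimal achievable distortion under the intersection privacy budget `T`: the infimum of
the distortion over all release mechanisms whose intersection privacy is at most `T`. -/
noncomputable def optDistortion {k d : ℕ} (P : Measure (Param k)) (g : Fin d ↪ Fin k ⊕ Fin k)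
    (ε : Fin d → ℝ) (T : ℝ≥0∞) : ℝ≥0∞ :=
  ⨅ (M : Kernel (Param k) (Param k)) (_ : IsMarkovKernel M) (_ : interPrivacy P g ε M ≤ T),
    distortion P M

/-- The uniform distribution on the interval from `a` to `b`. -/
noncomputable def uniformLaw (a b : ℝ) : Measure ℝ := cond volume (Set.Icc a b)

/-- The parameter released by the quantization mechanism when its internal randomness is `u`: the
`i`-th secret parameter becomes `lo i + ⌊(gᵢ(θ) - lo i) / s i⌋ * s i + u i`, and the non-secret
parameters keep their values. -/
noncomputable def quantize {k d : ℕ} (g : Fin d ↪ Fin k ⊕ Fin k) (lo s : Fin d → ℝ)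
    (θ : Param k) (u : Fin d → ℝ) : Param k :=
  Function.extend g (fun i => lo i + ⌊(θ (g i) - lo i) / s i⌋ * s i + u i) θ

theorem measurable_quantize {k d : ℕ} (g : Fin d ↪ Fin k ⊕ Fin k) (lo s : Fin d → ℝ) :
    Measurable fun z : Param k × (Fin d → ℝ) => quantize g lo s z.1 z.2 := by
  refine measurable_pi_iff.2 fun c => ?_
  by_cases hc : ∃ i, g i = c
  · obtain ⟨i, rfl⟩ := hc
    simp only [quantize, g.injective.extend_apply]
    fun_prop
  · simp only [quantize, Function.extend_apply' _ _ _ hc]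
    fun_prop

/-- The quantization release mechanism, with `u i` drawn independently and uniformly
from `(0, s i)`. -/
noncomputable def quantMechanism {k d : ℕ} (g : Fin d ↪ Fin k ⊕ Fin k) (lo s : Fin d → ℝ) :
    Kernel (Param k) (Param k) :=
  (Kernel.id ×ₖ Kernel.const (Param k) (Measure.pi fun i => uniformLaw 0 (s i))).map
    fun z => quantize g lo s z.1 z.2

end SummaryPrivacy

/-!
`W₂` between two Gaussians with independent coordinates is the Euclidean distance between their
parameters `(μ, |σ|)`: Cauchy–Schwarz bounds every coupling from below, and pushing one standard
Gaussian vector through both affine maps attains the bound.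

The release reveals exactly the bin of each secret, plus noise independent of everything. Given its
bin, a secret is uniform on it, so no guess beats the center, which succeeds with probability
`2 * ε i / s i`; over independent secrets these probabilities multiply. A release stays in the bin,
so it moves secret `i` by at most `s i`; the support of the prior reaches the corner `lo` and the
releases from there reach `lo + s`, which makes the distortion `√(∑ i, s i ^ 2)`.

A mechanism with distortion below every `ε i` keeps each secret within its tolerance, so the
attacker who echoes the release always wins. Hence every `e ≤ min ε` bounds the optimal distortion
from below for all budgets `T < 1`, and `√(∑ i, s i ^ 2) / e + 1` serves as the constant.
-/

namespace SummaryPrivacy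

section General

theorem exists_pos_forall_le {ι : Type*} [Finite ι] {ε : ι → ℝ} (hε : ∀ i, 0 < ε i) :
    ∃ e : ℝ, 0 < e ∧ ∀ i, e ≤ ε i := by
  have hsmall : ∀ᶠ e in nhdsWithin (0 : ℝ) (Set.Ioi 0), ∀ i, e ≤ ε i :=
    Filter.eventually_all.2 fun i => nhdsWithin_le_nhds (eventually_le_nhds (hε i))
  exact (eventually_mem_nhdsWithin.and hsmall).exists

theorem tsum_measure_preimage_singleton_inter {α β : Type*} [MeasurableSpace α]
    [MeasurableSpace β] [Countable β] [MeasurableSingletonClass β] (μ : Measure α) {f : α → β}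
    (hf : Measurable f) (t : Set α) : ∑' y, μ (f ⁻¹' {y} ∩ t) = μ t := by
  have hfiber (y : β) : MeasurableSet (f ⁻¹' {y}) := hf (measurableSet_singleton y)
  calc ∑' y, μ (f ⁻¹' {y} ∩ t)
      = ∑' y, μ.restrict t (f ⁻¹' {y}) := by simp only [Measure.restrict_apply (hfiber _)]
    _ = μ.restrict t (⋃ y, f ⁻¹' {y}) :=
        (measure_iUnion (pairwise_disjoint_fiber f) hfiber).symm
    _ = μ t := by
        rw [← Set.preimage_iUnion, Set.iUnion_of_singleton, Set.preimage_univ,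
          Measure.restrict_apply_univ]

theorem lintegral_le_of_indepFun {Ω α β : Type*} [MeasurableSpace Ω] [MeasurableSpace α]
    [MeasurableSpace β] {μ : Measure Ω} [IsProbabilityMeasure μ] {X : Ω → α} {Y : Ω → β}
    (hX : Measurable X) (hY : Measurable Y) (hXY : IndepFun X Y μ) {F : α × β → ℝ≥0∞}
    (hF : Measurable F) {K : ℝ≥0∞} (hK : ∀ y, ∫⁻ x, F (x, y) ∂μ.map X ≤ K) :
    ∫⁻ ω, F (X ω, Y ω) ∂μ ≤ K := by
  have := Measure.isProbabilityMeasure_map (μ := μ) hX.aemeasurable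
  have := Measure.isProbabilityMeasure_map (μ := μ) hY.aemeasurable
  calc ∫⁻ ω, F (X ω, Y ω) ∂μ = ∫⁻ z, F z ∂μ.map (fun ω => (X ω, Y ω)) :=
        (lintegral_map hF (hX.prodMk hY)).symm
    _ = ∫⁻ y, ∫⁻ x, F (x, y) ∂μ.map X ∂μ.map Y := by
        rw [(indepFun_iff_map_prod_eq_prod_map_map hX.aemeasurable hY.aemeasurable).1 hXY,
          lintegral_prod_symm _ hF.aemeasurable]
    _ ≤ ∫⁻ _, K ∂μ.map Y := lintegral_mono hK
    _ = K := by simp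

theorem mem_support_pi {ι : Type*} [Fintype ι] {X : ι → Type*} [∀ i, TopologicalSpace (X i)]
    [∀ i, MeasurableSpace (X i)] {μ : ∀ i, Measure (X i)} [∀ i, SigmaFinite (μ i)] {x : ∀ i, X i}
    (hx : ∀ i, x i ∈ (μ i).support) : x ∈ (Measure.pi μ).support := by
  rw [Measure.mem_support_iff_forall]
  intro U hU
  rw [nhds_pi, Filter.mem_pi'] at hU
  obtain ⟨I, t, ht, hsub⟩ := hU
  refine lt_of_lt_of_le ?_ (measure_mono ((Set.pi_mono' (fun _ _ => subset_rfl)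
    (Set.subset_univ _)).trans hsub))
  rw [Measure.pi_pi, pos_iff_ne_zero, Finset.prod_ne_zero_iff]
  exact fun i _ => ((Measure.mem_support_iff_forall (x i)).1 (hx i) _ (ht i)).ne'

theorem map_mem_support_map {X Y : Type*} [TopologicalSpace X] [MeasurableSpace X]
    [OpensMeasurableSpace X] [TopologicalSpace Y] [MeasurableSpace Y] [BorelSpace Y]
    {μ : Measure X} {f : X → Y} (hf : Continuous f) {x : X} (hx : x ∈ μ.support) :
    f x ∈ (μ.map f).support := by
  rw [Measure.mem_support_iff_forall] at hx ⊢
  intro U hU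
  exact (hx _ (hf.continuousAt hU)).trans_le (Measure.le_map_apply hf.aemeasurable U)

end General

section Wasserstein

variable {Ω : Type*} {mΩ : MeasurableSpace Ω} {π : Measure Ω} {X Y : Ω → ℝ}

theorem covariance_le_sqrt_variance_mul_sqrt_variance [IsFiniteMeasure π]
    (hX : MemLp X 2 π) (hY : MemLp Y 2 π) :
    cov[X, Y; π] ≤ √Var[X; π] * √Var[Y; π] := by
  have quadratic_nonneg (t : ℝ) :
      0 ≤ Var[Y; π] * (t * t) + (-2 * cov[X, Y; π]) * t + Var[X; π] := by
    have h := variance_nonneg (X - t • Y) π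
    rw [variance_sub hX (hY.const_smul t), variance_smul, covariance_smul_right] at h
    linarith
  have cov_sq_le := discrim_le_zero quadratic_nonneg
  rw [discrim] at cov_sq_le
  rw [← Real.sqrt_mul (variance_nonneg X π)]
  exact Real.le_sqrt_of_sq_le (by linarith)

theorem lintegral_ofReal_sq [IsProbabilityMeasure π] (hX : MemLp X 2 π) :
    ∫⁻ ω, ENNReal.ofReal (X ω ^ 2) ∂π = ENNReal.ofReal (π[X] ^ 2 + Var[X; π]) := by
  rw [← ofReal_integral_eq_lintegral_ofReal hX.integrable_sq (ae_of_all _ fun _ => sq_nonneg _),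
    variance_eq_sub hX]
  simp

theorem ofReal_sq_add_sq_le_lintegral_sub_sq [IsProbabilityMeasure π]
    (hX : MemLp X 2 π) (hY : MemLp Y 2 π) :
    ENNReal.ofReal ((π[X] - π[Y]) ^ 2 + (√Var[X; π] - √Var[Y; π]) ^ 2)
      ≤ ∫⁻ ω, ENNReal.ofReal ((X ω - Y ω) ^ 2) ∂π := by
  have h := lintegral_ofReal_sq (hX.sub hY)
  simp only [Pi.sub_apply] at h
  rw [h, integral_sub (hX.integrable one_le_two) (hY.integrable one_le_two),
    variance_sub hX hY, sub_sq (√Var[X; π]), Real.sq_sqrt (variance_nonneg X π),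
    Real.sq_sqrt (variance_nonneg Y π)]
  have := covariance_le_sqrt_variance_mul_sqrt_variance hX hY
  exact ENNReal.ofReal_le_ofReal (by linarith)

theorem wasserstein2_map_le {E : Type*} [PseudoEMetricSpace E] [MeasurableSpace E]
    {f g : Ω → E} (hf : Measurable f) (hg : Measurable g) :
    wasserstein2 (π.map f) (π.map g) ≤ (∫⁻ ω, edist (f ω) (g ω) ^ 2 ∂π) ^ (1 / 2 : ℝ) := by
  have hfg : Measurable fun ω => (f ω, g ω) := hf.prodMk hg
  have hcoupling : (π.map fun ω => (f ω, g ω)).map Prod.fst = π.map f ∧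
      (π.map fun ω => (f ω, g ω)).map Prod.snd = π.map g :=
    ⟨Measure.map_map measurable_fst hfg, Measure.map_map measurable_snd hfg⟩
  exact ENNReal.rpow_le_rpow (iInf₂_le_of_le (π.map fun ω => (f ω, g ω)) hcoupling
    (lintegral_map_le (fun z : E × E => edist z.1 z.2 ^ 2) _)) (by norm_num)

variable {ι : Type*} [Fintype ι]

theorem lintegral_edist_sq_eq_sum {f g : Ω → EuclideanSpace ℝ ι} (hf : Measurable f)
    (hg : Measurable g) :
    ∫⁻ ω, edist (f ω) (g ω) ^ 2 ∂π
      = ∑ j, ∫⁻ ω, ENNReal.ofReal ((f ω j - g ω j) ^ 2) ∂π := by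
  have edist_sq (x y : EuclideanSpace ℝ ι) :
      edist x y ^ 2 = ∑ j, ENNReal.ofReal ((x j - y j) ^ 2) := by
    rw [edist_dist, ← ENNReal.ofReal_pow dist_nonneg, EuclideanSpace.dist_eq,
      Real.sq_sqrt (Finset.sum_nonneg fun _ _ => sq_nonneg _),
      ENNReal.ofReal_sum_of_nonneg fun _ _ => sq_nonneg _]
    simp [Real.dist_eq]
  simp_rw [edist_sq]
  exact lintegral_finsetSum _ fun j _ => by fun_prop

theorem ofReal_sqrt_sum_le_wasserstein2 {μ ν : Measure (EuclideanSpace ℝ ι)}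
    [IsProbabilityMeasure μ] (hμ : ∀ j, MemLp (fun x => x j) 2 μ)
    (hν : ∀ j, MemLp (fun x => x j) 2 ν) :
    ENNReal.ofReal (√(∑ j, ((∫ x, x j ∂μ - ∫ x, x j ∂ν) ^ 2
        + (√Var[fun x => x j; μ] - √Var[fun x => x j; ν]) ^ 2)))
      ≤ wasserstein2 μ ν := by
  rw [Real.sqrt_eq_rpow, ← ENNReal.ofReal_rpow_of_nonneg
    (Finset.sum_nonneg fun _ _ => by positivity) (by norm_num)]
  refine ENNReal.rpow_le_rpow (le_iInf₂ fun π ⟨hfst, hsnd⟩ => ?_) (by norm_num)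
  have h1 : MeasurePreserving Prod.fst π μ := ⟨measurable_fst, hfst⟩
  have h2 : MeasurePreserving Prod.snd π ν := ⟨measurable_snd, hsnd⟩
  have : IsProbabilityMeasure π :=
    ⟨by simpa using h1.measure_preimage (s := Set.univ) nullMeasurableSet_univ⟩
  rw [lintegral_edist_sq_eq_sum measurable_fst measurable_snd,
    ENNReal.ofReal_sum_of_nonneg fun _ _ => by positivity]
  refine Finset.sum_le_sum fun j _ => ?_
  have heval : Measurable fun x : EuclideanSpace ℝ ι => x j := by fun_prop
  have mean_fst : ∫ z, z.1 j ∂π = ∫ x, x j ∂μ := by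
    rw [← hfst, integral_map measurable_fst.aemeasurable heval.aestronglyMeasurable]
  have mean_snd : ∫ z, z.2 j ∂π = ∫ x, x j ∂ν := by
    rw [← hsnd, integral_map measurable_snd.aemeasurable heval.aestronglyMeasurable]
  have var_fst : Var[fun z => z.1 j; π] = Var[fun x => x j; μ] := by
    rw [← hfst, variance_map heval.aemeasurable measurable_fst.aemeasurable]
    rfl
  have var_snd : Var[fun z => z.2 j; π] = Var[fun x => x j; ν] := by
    rw [← hsnd, variance_map heval.aemeasurable measurable_snd.aemeasurable]
    rfl
  have h := ofReal_sq_add_sq_le_lintegral_sub_sq ((hμ j).comp_measurePreserving h1)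
    ((hν j).comp_measurePreserving h2)
  simp only [Function.comp_def] at h
  rwa [mean_fst, mean_snd, var_fst, var_snd] at h

end Wasserstein

section Gaussian

variable {k : ℕ}

theorem measurePreserving_eval_gaussianLaw (θ : Param k) (j : Fin k) :
    MeasurePreserving (fun x => x j) (gaussianLaw θ)
      (gaussianReal (θ (Sum.inl j)) (θ (Sum.inr j) ^ 2).toNNReal) := by
  have hS : (Matrix.diagonal fun j => θ (Sum.inr j) ^ 2).PosSemidef :=
    Matrix.posSemidef_diagonal_iff.2 fun _ => sq_nonneg _
  simpa [gaussianLaw] using measurePreserving_eval_multivariateGaussian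
    (μ := WithLp.toLp 2 fun j => θ (Sum.inl j)) hS (i := j)

theorem memLp_eval_gaussianLaw (θ : Param k) (j : Fin k) :
    MemLp (fun x : EuclideanSpace ℝ (Fin k) => x j) 2 (gaussianLaw θ) :=
  (memLp_id_gaussianReal' 2 (by simp)).comp_measurePreserving
    (measurePreserving_eval_gaussianLaw θ j)

theorem integral_eval_gaussianLaw (θ : Param k) (j : Fin k) :
    ∫ x, x j ∂gaussianLaw θ = θ (Sum.inl j) := by
  have h := measurePreserving_eval_gaussianLaw θ j
  rw [← integral_map (f := fun y => y) h.aemeasurable aestronglyMeasurable_id, h.map_eq,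
    integral_id_gaussianReal]

theorem variance_eval_gaussianLaw (θ : Param k) (j : Fin k) :
    Var[fun x => x j; gaussianLaw θ] = θ (Sum.inr j) ^ 2 := by
  have h := (measurePreserving_eval_gaussianLaw θ j).variance_fun_comp aemeasurable_id
  simpa [sq_nonneg] using h

/-- The affine map `x ↦ μ + |σ| x` (coordinatewise) carrying the standard Gaussian to
`gaussianLaw θ`; the maps of two parameters, applied to one standard Gaussian vector, form the
optimal coupling of their Gaussians. -/
noncomputable def gaussianTransport (θ : Param k) (x : EuclideanSpace ℝ (Fin k)) :
    EuclideanSpace ℝ (Fin k) :=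
  WithLp.toLp 2 fun j => θ (Sum.inl j) + |θ (Sum.inr j)| * x j

theorem measurable_gaussianTransport (θ : Param k) : Measurable (gaussianTransport θ) := by
  unfold gaussianTransport
  fun_prop

open scoped MatrixOrder in
theorem sqrt_diagonal_sq {ι : Type*} [Fintype ι] [DecidableEq ι] (v : ι → ℝ) :
    CFC.sqrt (Matrix.diagonal fun j => v j ^ 2) = Matrix.diagonal fun j => |v j| := by
  refine CFC.sqrt_unique ?_ ?_
  · simp [Matrix.diagonal_mul_diagonal, sq]
  · exact (Matrix.posSemidef_diagonal_iff.2 fun _ => abs_nonneg _).nonneg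

theorem map_gaussianTransport_stdGaussian (θ : Param k) :
    (stdGaussian (EuclideanSpace ℝ (Fin k))).map (gaussianTransport θ) = gaussianLaw θ := by
  unfold gaussianLaw multivariateGaussian
  congr 1
  ext x j
  simp [sqrt_diagonal_sq, gaussianTransport, Matrix.mulVec_diagonal]

theorem measurePreserving_eval_stdGaussian {ι : Type*} [Fintype ι] (j : ι) :
    MeasurePreserving (fun x => x j) (stdGaussian (EuclideanSpace ℝ ι)) (gaussianReal 0 1) := by
  classical
  simpa [multivariateGaussian_zero_one] using
    measurePreserving_eval_multivariateGaussian (μ := 0) Matrix.PosSemidef.one (i := j)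

theorem lintegral_ofReal_affine_sq_gaussianReal (p q : ℝ) :
    ∫⁻ y, ENNReal.ofReal ((p + q * y) ^ 2) ∂gaussianReal 0 1 = ENNReal.ofReal (p ^ 2 + q ^ 2) := by
  have hid : MemLp (fun y : ℝ => y) 2 (gaussianReal 0 1) := memLp_id_gaussianReal' 2 (by simp)
  have hlin : MemLp (fun y : ℝ => q * y) 2 (gaussianReal 0 1) := hid.const_mul q
  have haff : MemLp (fun y : ℝ => p + q * y) 2 (gaussianReal 0 1) := (memLp_const p).add hlin
  rw [lintegral_ofReal_sq haff, variance_const_add hlin.aestronglyMeasurable, variance_const_mul,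
    integral_add (integrable_const p) (hlin.integrable one_le_two), integral_const_mul]
  simp

/-- The parameter with each standard deviation replaced by its absolute value: the canonical
parameter with the same Gaussian, since `gaussianLaw` only sees the squares `σⱼ²`. -/
noncomputable def absDev (θ : Param k) : Param k :=
  Sum.elim (fun j => θ (Sum.inl j)) fun j => |θ (Sum.inr j)|

theorem sum_absDev_sub_sq (θ θ' : Param k) :
    ∑ c, (absDev θ c - absDev θ' c) ^ 2
      = ∑ j, ((θ (Sum.inl j) - θ' (Sum.inl j)) ^ 2
        + (|θ (Sum.inr j)| - |θ' (Sum.inr j)|) ^ 2) := by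
  simp [Fintype.sum_sum_type, absDev, Finset.sum_add_distrib]

theorem wasserstein2_gaussianLaw (θ θ' : Param k) :
    wasserstein2 (gaussianLaw θ) (gaussianLaw θ')
      = ENNReal.ofReal (√(∑ c, (absDev θ c - absDev θ' c) ^ 2)) := by
  rw [sum_absDev_sub_sq]
  apply le_antisymm
  · rw [← map_gaussianTransport_stdGaussian θ, ← map_gaussianTransport_stdGaussian θ']
    refine (wasserstein2_map_le (measurable_gaussianTransport θ)
      (measurable_gaussianTransport θ')).trans_eq ?_
    rw [lintegral_edist_sq_eq_sum (measurable_gaussianTransport θ)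
      (measurable_gaussianTransport θ'), Real.sqrt_eq_rpow, ← ENNReal.ofReal_rpow_of_nonneg
      (Finset.sum_nonneg fun _ _ => by positivity) (by norm_num),
      ENNReal.ofReal_sum_of_nonneg fun _ _ => by positivity]
    congr 1
    refine Finset.sum_congr rfl fun j _ => ?_
    rw [← lintegral_ofReal_affine_sq_gaussianReal,
      ← (measurePreserving_eval_stdGaussian j).lintegral_comp (by fun_prop)]
    congr! 4 with x
    simp only [gaussianTransport]
    ring
  · have : IsProbabilityMeasure (gaussianLaw θ) := by unfold gaussianLaw; infer_instance
    simpa only [integral_eval_gaussianLaw, variance_eval_gaussianLaw, Real.sqrt_sq_eq_abs]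
      using ofReal_sqrt_sum_le_wasserstein2 (memLp_eval_gaussianLaw θ) (memLp_eval_gaussianLaw θ')

theorem abs_absDev_sub_le (θ θ' : Param k) (c : Fin k ⊕ Fin k) :
    |absDev θ c - absDev θ' c| ≤ |θ c - θ' c| := by
  rcases c with j | j
  · simp [absDev]
  · simpa [absDev] using abs_abs_sub_abs_le _ _

theorem absDev_apply_of_nonneg {θ : Param k} {c : Fin k ⊕ Fin k}
    (h : c.isRight → 0 ≤ θ c) : absDev θ c = θ c := by
  rcases c with j | j
  · rfl
  · exact abs_of_nonneg (h rfl)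

theorem continuous_absDev : Continuous (absDev (k := k)) := by
  refine continuous_pi fun c => ?_
  rcases c with j | j
  · exact continuous_apply _
  · exact (continuous_apply (Sum.inr j : Fin k ⊕ Fin k)).abs

theorem continuous_wasserstein2_gaussianLaw (θ : Param k) :
    Continuous fun θ' => wasserstein2 (gaussianLaw θ) (gaussianLaw θ') := by
  have (c : Fin k ⊕ Fin k) : Continuous fun θ' : Param k => absDev θ' c :=
    (continuous_apply c).comp continuous_absDev
  simp only [wasserstein2_gaussianLaw]
  exact ENNReal.continuous_ofReal.comp (by fun_prop)

end Gaussian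

section Uniform

variable {a b lo s ε : ℝ} {N : ℕ}

theorem uniformLaw_apply (a b : ℝ) (t : Set ℝ) :
    uniformLaw a b t = (ENNReal.ofReal (b - a))⁻¹ * volume (Set.Icc a b ∩ t) := by
  rw [uniformLaw, cond_apply measurableSet_Icc, Real.volume_Icc]

instance : IsZeroOrProbabilityMeasure (uniformLaw a b) := by
  unfold uniformLaw
  infer_instance

theorem isProbabilityMeasure_uniformLaw (hab : a < b) :
    IsProbabilityMeasure (uniformLaw a b) :=
  cond_isProbabilityMeasure_of_finite (by simpa using hab) (by simp)

theorem uniformLaw_setOf_abs_sub_le (hab : a < b) (c : ℝ) :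
    uniformLaw a b {x | |c - x| ≤ ε} ≤ ENNReal.ofReal (2 * ε / (b - a)) := by
  have hball : {x | |c - x| ≤ ε} ⊆ Set.Icc (c - ε) (c + ε) := fun x hx => by
    have := abs_le.1 (Set.mem_ofPred.1 hx)
    constructor <;> linarith
  calc uniformLaw a b {x | |c - x| ≤ ε}
      ≤ (ENNReal.ofReal (b - a))⁻¹ * volume (Set.Icc (c - ε) (c + ε)) := by
        rw [uniformLaw_apply]
        gcongr
        exact Set.inter_subset_right.trans hball
    _ = ENNReal.ofReal (2 * ε / (b - a)) := by
        rw [Real.volume_Icc, ENNReal.ofReal_div_of_pos (sub_pos.2 hab), ENNReal.div_eq_inv_mul]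
        ring_nf

theorem le_uniformLaw_setOf_abs_midpoint_sub_le (hab : a < b) (hε : 2 * ε ≤ b - a) :
    ENNReal.ofReal (2 * ε / (b - a)) ≤ uniformLaw a b {x | |(a + b) / 2 - x| ≤ ε} := by
  have hball : Set.Icc ((a + b) / 2 - ε) ((a + b) / 2 + ε)
      ⊆ Set.Icc a b ∩ {x | |(a + b) / 2 - x| ≤ ε} := fun x hx => by
    have hx' : |(a + b) / 2 - x| ≤ ε := abs_le.2 ⟨by linarith [hx.2], by linarith [hx.1]⟩
    exact ⟨⟨by linarith [hx.1], by linarith [hx.2]⟩, hx'⟩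
  calc ENNReal.ofReal (2 * ε / (b - a))
      = (ENNReal.ofReal (b - a))⁻¹ * volume (Set.Icc ((a + b) / 2 - ε) ((a + b) / 2 + ε)) := by
        rw [Real.volume_Icc, ENNReal.ofReal_div_of_pos (sub_pos.2 hab), ENNReal.div_eq_inv_mul]
        ring_nf
    _ ≤ uniformLaw a b {x | |(a + b) / 2 - x| ≤ ε} := by
        rw [uniformLaw_apply]
        gcongr

theorem cond_uniformLaw_Ico {c d : ℝ} (h : Set.Ico c d ⊆ Set.Icc a b) :
    (uniformLaw a b)[|Set.Ico c d] = uniformLaw c d := by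
  rw [uniformLaw, cond_cond_eq_cond_inter' measurableSet_Icc measurableSet_Ico (by simp),
    Set.inter_eq_right.2 h, uniformLaw, ProbabilityTheory.cond, ProbabilityTheory.cond,
    Measure.restrict_congr_set Ico_ae_eq_Icc, measure_congr Ico_ae_eq_Icc]

theorem ae_uniformLaw_mem_Icc (a b : ℝ) : ∀ᵐ x ∂uniformLaw a b, x ∈ Set.Icc a b :=
  ae_cond_mem measurableSet_Icc

theorem ae_uniformLaw_mem_Ico (a b : ℝ) : ∀ᵐ x ∂uniformLaw a b, x ∈ Set.Ico a b := by
  have hne : ∀ᵐ x ∂uniformLaw a b, x ≠ b :=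
    cond_absolutelyContinuous.ae_le (Measure.ae_ne volume b)
  filter_upwards [ae_uniformLaw_mem_Icc a b, hne] with x hx hxb
  exact ⟨hx.1, hx.2.lt_of_ne hxb⟩

theorem support_uniformLaw (hab : a < b) : (uniformLaw a b).support = Set.Icc a b := by
  refine (Measure.support_subset_of_isClosed isClosed_Icc (ae_uniformLaw_mem_Icc a b)).antisymm ?_
  rw [← closure_Ioo hab.ne]
  refine closure_minimal (fun x hx => ?_) Measure.isClosed_support
  refine (Measure.mem_support_iff_forall x).2 fun U hU => ?_
  rw [uniformLaw_apply]
  refine ENNReal.mul_pos (by simp) (Measure.measure_pos_of_mem_nhds volume (x := x) ?_).ne'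
  exact Filter.inter_mem (Icc_mem_nhds hx.1 hx.2) hU

/-- The index `n` of the quantization bin `[lo + n * s, lo + (n + 1) * s)` containing `x`. -/
noncomputable def binIndex (lo s x : ℝ) : ℤ := ⌊(x - lo) / s⌋

theorem measurable_binIndex (lo s : ℝ) : Measurable (binIndex lo s) := by
  unfold binIndex
  fun_prop

theorem binIndex_eq_iff (hs : 0 < s) {n : ℤ} {x : ℝ} :
    binIndex lo s x = n ↔ x ∈ Set.Ico (lo + n * s) (lo + (n + 1) * s) := by
  rw [binIndex, Int.floor_eq_iff, le_div_iff₀ hs, div_lt_iff₀ hs, Set.mem_Ico,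
    le_sub_iff_add_le', sub_lt_iff_lt_add']

/-- The center of the quantization bin containing `x`: the optimal guess of a secret `x` when only
its bin is known. -/
noncomputable def binCenter (lo s x : ℝ) : ℝ := lo + (binIndex lo s x + 1 / 2) * s

theorem measurable_binCenter (lo s : ℝ) : Measurable (binCenter lo s) := by
  unfold binCenter binIndex
  fun_prop

theorem preimage_binIndex_singleton (hs : 0 < s) (n : ℤ) :
    binIndex lo s ⁻¹' {n} = Set.Ico (lo + n * s) (lo + (n + 1) * s) :=
  Set.ext fun _ => binIndex_eq_iff hs

/-- Bins that stick out of the range are null, hence harmless in this identity. -/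
theorem uniformLaw_preimage_binIndex_inter (hs : 0 < s) (n : ℤ) (t : Set ℝ) :
    uniformLaw lo (lo + N * s) (binIndex lo s ⁻¹' {n} ∩ t)
      = uniformLaw (lo + n * s) (lo + (n + 1) * s) t
        * uniformLaw lo (lo + N * s) (binIndex lo s ⁻¹' {n}) := by
  rw [preimage_binIndex_singleton hs]
  by_cases hn : 0 ≤ n ∧ n < N
  · have h0 : (0 : ℝ) ≤ n := mod_cast hn.1
    have hN : (n : ℝ) + 1 ≤ N := mod_cast hn.2
    have hsub : Set.Ico (lo + n * s) (lo + (n + 1) * s) ⊆ Set.Icc lo (lo + N * s) := by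
      refine Set.Ico_subset_Icc_self.trans (Set.Icc_subset_Icc ?_ (by gcongr))
      simpa using mul_nonneg h0 hs.le
    rw [← cond_uniformLaw_Ico hsub, cond_mul_eq_inter measurableSet_Ico]
  · have hnull : uniformLaw lo (lo + N * s) (Set.Ico (lo + n * s) (lo + (n + 1) * s)) = 0 := by
      refine measure_eq_zero_iff_ae_notMem.2 ?_
      filter_upwards [ae_uniformLaw_mem_Ico lo (lo + N * s)] with x hx hxn
      refine hn ⟨?_, ?_⟩
      · have : (0 : ℝ) < (n + 1) * s := by linarith [hx.1, hxn.2]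
        have : (0 : ℝ) < n + 1 := pos_of_mul_pos_left this hs.le
        exact Int.lt_add_one_iff.1 (mod_cast this)
      · have : (n : ℝ) * s < N * s := by linarith [hx.2, hxn.1]
        exact_mod_cast lt_of_mul_lt_mul_right this hs.le
    rw [measure_inter_null_of_null_left _ hnull, hnull, mul_zero]

theorem le_uniformLaw_preimage_binIndex_inter_abs_binCenter_sub_le (hs : 0 < s)
    (hε : 2 * ε ≤ s) (n : ℤ) :
    ENNReal.ofReal (2 * ε / s) * uniformLaw lo (lo + N * s) (binIndex lo s ⁻¹' {n})
      ≤ uniformLaw lo (lo + N * s)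
        (binIndex lo s ⁻¹' {n} ∩ {x | |binCenter lo s x - x| ≤ ε}) := by
  have hlength : lo + (n + 1) * s - (lo + n * s) = s := by ring
  have hcenter : lo + (n + 1 / 2) * s = (lo + n * s + (lo + (n + 1) * s)) / 2 := by ring
  have hcongr : binIndex lo s ⁻¹' {n} ∩ {x | |binCenter lo s x - x| ≤ ε}
      = binIndex lo s ⁻¹' {n} ∩ {x | |(lo + n * s + (lo + (n + 1) * s)) / 2 - x| ≤ ε} := by
    ext x
    refine and_congr_right fun hx => ?_
    rw [Set.mem_ofPred, Set.mem_ofPred, binCenter, Set.mem_singleton_iff.1 hx, hcenter]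
  rw [hcongr, uniformLaw_preimage_binIndex_inter hs]
  gcongr
  simpa only [hlength] using
    le_uniformLaw_setOf_abs_midpoint_sub_le (ε := ε) (a := lo + n * s) (b := lo + (n + 1) * s)
      (by linarith) (by linarith)

theorem uniformLaw_preimage_binIndex_inter_abs_sub_le (hs : 0 < s) (n : ℤ) (c : ℝ) :
    uniformLaw lo (lo + N * s) (binIndex lo s ⁻¹' {n} ∩ {x | |c - x| ≤ ε})
      ≤ ENNReal.ofReal (2 * ε / s) * uniformLaw lo (lo + N * s) (binIndex lo s ⁻¹' {n}) := by
  have hlength : lo + (n + 1) * s - (lo + n * s) = s := by ring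
  rw [uniformLaw_preimage_binIndex_inter hs]
  gcongr
  simpa only [hlength] using
    uniformLaw_setOf_abs_sub_le (ε := ε) (a := lo + n * s) (b := lo + (n + 1) * s)
      (by linarith) c

theorem le_uniformLaw_setOf_abs_binCenter_sub_le (hs : 0 < s) (hε : 2 * ε ≤ s) (hN : 0 < N) :
    ENNReal.ofReal (2 * ε / s)
      ≤ uniformLaw lo (lo + N * s) {x | |binCenter lo s x - x| ≤ ε} := by
  have := isProbabilityMeasure_uniformLaw (lt_add_of_pos_right lo (by positivity : 0 < N * s))
  have htotal (t : Set ℝ) :=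
    tsum_measure_preimage_singleton_inter (uniformLaw lo (lo + N * s)) (measurable_binIndex lo s) t
  calc ENNReal.ofReal (2 * ε / s)
      = ∑' n, ENNReal.ofReal (2 * ε / s)
          * uniformLaw lo (lo + N * s) (binIndex lo s ⁻¹' {n} ∩ Set.univ) := by
        rw [ENNReal.tsum_mul_left, htotal, measure_univ, mul_one]
    _ ≤ ∑' n, uniformLaw lo (lo + N * s)
          (binIndex lo s ⁻¹' {n} ∩ {x | |binCenter lo s x - x| ≤ ε}) := by
        simp only [Set.inter_univ]
        exact ENNReal.tsum_le_tsum
          (le_uniformLaw_preimage_binIndex_inter_abs_binCenter_sub_le hs hε)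
    _ = _ := htotal _

end Uniform

section Guess

/-- On each fiber of `b` the randomized guess `A (b x)` has a fixed law, so by Tonelli it does no
better than the best deterministic guess. -/
theorem lintegral_guess_le {α β γ : Type*} [MeasurableSpace α] [MeasurableSpace β] [Countable β]
    [MeasurableSingletonClass β] [MeasurableSpace γ] {Q : Measure α} [SFinite Q]
    {b : α → β} (hb : Measurable b) (A : β → Measure γ) [∀ y, IsProbabilityMeasure (A y)]
    {S : Set (α × γ)} (hS : MeasurableSet S) {K : ℝ≥0∞}
    (hK : ∀ y a, Q (b ⁻¹' {y} ∩ {x | (x, a) ∈ S}) ≤ K * Q (b ⁻¹' {y})) :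
    ∫⁻ x, A (b x) {a | (x, a) ∈ S} ∂Q ≤ K * Q Set.univ := by
  have hfiber (y : β) : MeasurableSet (b ⁻¹' {y}) := hb (measurableSet_singleton y)
  have hcover : ⋃ y, b ⁻¹' {y} = Set.univ := by
    rw [← Set.preimage_iUnion, Set.iUnion_of_singleton, Set.preimage_univ]
  have fiber_le (y : β) :
      ∫⁻ x in b ⁻¹' {y}, A (b x) {a | (x, a) ∈ S} ∂Q ≤ K * Q (b ⁻¹' {y}) := by
    calc ∫⁻ x in b ⁻¹' {y}, A (b x) {a | (x, a) ∈ S} ∂Q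
        = ∫⁻ x in b ⁻¹' {y}, A y {a | (x, a) ∈ S} ∂Q :=
          setLIntegral_congr_fun (hfiber y) fun x hx => by
            simp only [Set.mem_singleton_iff.1 hx]
      _ = ∫⁻ a, Q.restrict (b ⁻¹' {y}) {x | (x, a) ∈ S} ∂A y :=
          (Measure.prod_apply hS).symm.trans (Measure.prod_apply_symm hS)
      _ ≤ ∫⁻ _, K * Q (b ⁻¹' {y}) ∂A y := lintegral_mono fun a => by
          rw [Measure.restrict_apply' (hfiber y), Set.inter_comm]
          exact hK y a
      _ = K * Q (b ⁻¹' {y}) := by simp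
  calc ∫⁻ x, A (b x) {a | (x, a) ∈ S} ∂Q
      = ∑' y, ∫⁻ x in b ⁻¹' {y}, A (b x) {a | (x, a) ∈ S} ∂Q := by
        rw [← lintegral_iUnion hfiber (pairwise_disjoint_fiber b), hcover, Measure.restrict_univ]
    _ ≤ ∑' y, K * Q (b ⁻¹' {y} ∩ Set.univ) :=
        ENNReal.tsum_le_tsum fun y => by simpa only [Set.inter_univ] using fiber_le y
    _ = K * Q Set.univ := by
        rw [ENNReal.tsum_mul_left, tsum_measure_preimage_singleton_inter Q hb]

theorem measurableSet_forall_abs_sub_le {ι : Type*} [Countable ι] (ε : ι → ℝ) :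
    MeasurableSet {z : (ι → ℝ) × (ι → ℝ) | ∀ i, |z.2 i - z.1 i| ≤ ε i} := by
  simp only [Set.ofPred_forall]
  exact MeasurableSet.iInter fun i => measurableSet_le (by fun_prop) measurable_const

variable {ι : Type*} [Fintype ι] {ε s lo : ι → ℝ} {N : ι → ℕ}

theorem lintegral_guess_pi_uniformLaw_le (hs : ∀ i, 0 < s i) (A : (ι → ℤ) → Measure (ι → ℝ))
    [∀ n, IsProbabilityMeasure (A n)] :
    ∫⁻ x, A (fun i => binIndex (lo i) (s i) (x i)) {a | ∀ i, |a i - x i| ≤ ε i}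
        ∂Measure.pi (fun i => uniformLaw (lo i) (lo i + N i * s i))
      ≤ ∏ i, ENNReal.ofReal (2 * ε i / s i) := by
  have hbins : Measurable fun (x : ι → ℝ) i => binIndex (lo i) (s i) (x i) :=
    measurable_pi_lambda _ fun i => (measurable_binIndex _ _).comp (measurable_pi_apply i)
  refine (lintegral_guess_le (K := ∏ i, ENNReal.ofReal (2 * ε i / s i)) hbins A
    (measurableSet_forall_abs_sub_le ε) fun n a => ?_).trans
    (mul_le_of_le_one_right' ?_)
  swap
  · rw [Measure.pi_univ]
    exact Finset.prod_le_one' fun i _ => prob_le_one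
  have hbin : (fun (x : ι → ℝ) i => binIndex (lo i) (s i) (x i)) ⁻¹' {n}
      = Set.univ.pi fun i => binIndex (lo i) (s i) ⁻¹' {n i} := by
    ext x; simp [funext_iff]
  have hguess : {x : ι → ℝ | (x, a) ∈ {z : (ι → ℝ) × (ι → ℝ) | ∀ i, |z.2 i - z.1 i| ≤ ε i}}
      = Set.univ.pi fun i => {x | |a i - x| ≤ ε i} := by
    ext x; simp
  rw [hbin, hguess, ← Set.pi_inter_distrib, Measure.pi_pi, Measure.pi_pi,
    ← Finset.prod_mul_distrib]
  exact Finset.prod_le_prod' fun i _ =>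
    uniformLaw_preimage_binIndex_inter_abs_sub_le (hs i) (n i) (a i)

theorem le_pi_uniformLaw_setOf_abs_binCenter_sub_le (hs : ∀ i, 0 < s i)
    (hε : ∀ i, 2 * ε i ≤ s i) (hN : ∀ i, 0 < N i) :
    ∏ i, ENNReal.ofReal (2 * ε i / s i)
      ≤ Measure.pi (fun i => uniformLaw (lo i) (lo i + N i * s i))
        {x | ∀ i, |binCenter (lo i) (s i) (x i) - x i| ≤ ε i} := by
  have hbox : {x : ι → ℝ | ∀ i, |binCenter (lo i) (s i) (x i) - x i| ≤ ε i}
      = Set.univ.pi fun i => {x | |binCenter (lo i) (s i) x - x| ≤ ε i} := by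
    ext x; simp
  rw [hbox, Measure.pi_pi]
  exact Finset.prod_le_prod' fun i _ =>
    le_uniformLaw_setOf_abs_binCenter_sub_le (hs i) (hε i) (hN i)

end Guess

section Privacy

variable {k d : ℕ} {g : Fin d ↪ Fin k ⊕ Fin k} {ε s lo : Fin d → ℝ} {N : Fin d → ℕ}
  {P : Measure (Param k)}

theorem measurableSet_guess (g : Fin d ↪ Fin k ⊕ Fin k) (ε : Fin d → ℝ) :
    MeasurableSet {z : Param k × (Fin d → ℝ) | ∀ i, |z.2 i - z.1 (g i)| ≤ ε i} :=
  (measurableSet_forall_abs_sub_le ε).preimage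
    (f := fun z : Param k × (Fin d → ℝ) => (fun i => z.1 (g i), z.2)) (by fun_prop)

theorem interPrivacy_eq_iSup_lintegral (P : Measure (Param k)) [SFinite P]
    (g : Fin d ↪ Fin k ⊕ Fin k) (ε : Fin d → ℝ) (M : Kernel (Param k) (Param k))
    [IsSFiniteKernel M] :
    interPrivacy P g ε M = ⨆ (A : Kernel (Param k) (Fin d → ℝ)) (_ : IsMarkovKernel A),
      ∫⁻ θ, ∫⁻ θ', A θ' {a | ∀ i, |a i - θ (g i)| ≤ ε i} ∂M θ ∂P := by
  refine iSup_congr fun A => iSup_congr fun _ => ?_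
  have hS : MeasurableSet {z : (Param k × Param k) × (Fin d → ℝ) |
      ∀ i, |z.2 i - z.1.1 (g i)| ≤ ε i} :=
    (measurableSet_guess g ε).preimage
      (f := fun z : (Param k × Param k) × (Fin d → ℝ) => (z.1.1, z.2)) (by fun_prop)
  rw [Measure.compProd_apply hS,
    Measure.lintegral_compProd (Kernel.measurable_kernel_prodMk_left hS)]
  rfl

theorem measure_le_interPrivacy [SFinite P] {M : Kernel (Param k) (Param k)} [IsMarkovKernel M]
    {h : Param k → Fin d → ℝ} (hh : Measurable h) {E : Set (Param k)} (hE : MeasurableSet E)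
    (hguess : ∀ᵐ θ ∂P, θ ∈ E → ∀ᵐ θ' ∂M θ, ∀ i, |h θ' i - θ (g i)| ≤ ε i) :
    P E ≤ interPrivacy P g ε M := by
  rw [interPrivacy_eq_iSup_lintegral]
  refine le_iSup₂_of_le (Kernel.deterministic h hh) inferInstance ?_
  refine le_trans ?_ (setLIntegral_le_lintegral E _)
  rw [← setLIntegral_one]
  refine setLIntegral_mono_ae' hE ?_
  filter_upwards [hguess] with θ hθ hθE
  calc (1 : ℝ≥0∞) = ∫⁻ _, 1 ∂M θ := by simp
    _ ≤ _ := by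
      refine lintegral_mono_ae ?_
      filter_upwards [hθ hθE] with θ' hθ'
      rw [Kernel.deterministic_apply, Measure.dirac_apply_of_mem (Set.mem_ofPred.2 hθ')]

theorem quantMechanism_apply (g : Fin d ↪ Fin k ⊕ Fin k) (lo s : Fin d → ℝ) (θ : Param k) :
    quantMechanism g lo s θ
      = (Measure.pi fun i => uniformLaw 0 (s i)).map (quantize g lo s θ) := by
  have hm := measurable_quantize g lo s
  rw [quantMechanism, Kernel.map_apply _ hm, Kernel.prod_apply, Kernel.id_apply,
    Kernel.const_apply, Measure.dirac_prod, Measure.map_map hm (by fun_prop)]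
  rfl

theorem isMarkovKernel_quantMechanism (g : Fin d ↪ Fin k ⊕ Fin k) (lo : Fin d → ℝ)
    (hs : ∀ i, 0 < s i) : IsMarkovKernel (quantMechanism g lo s) := by
  have := fun i => isProbabilityMeasure_uniformLaw (hs i)
  exact Kernel.IsMarkovKernel.map _ (measurable_quantize g lo s)

theorem measurable_quantize_right (g : Fin d ↪ Fin k ⊕ Fin k) (lo s : Fin d → ℝ) (θ : Param k) :
    Measurable (quantize g lo s θ) :=
  Measurable.of_uncurry_left (f := quantize g lo s) (measurable_quantize g lo s)

theorem quantize_secret (θ : Param k) (u : Fin d → ℝ) (i : Fin d) :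
    quantize g lo s θ u (g i) = lo i + binIndex (lo i) (s i) (θ (g i)) * s i + u i := by
  simp [quantize, binIndex, g.injective.extend_apply]

theorem quantize_of_notMem_range (θ : Param k) (u : Fin d → ℝ) {c : Fin k ⊕ Fin k}
    (hc : c ∉ Set.range g) : quantize g lo s θ u c = θ c := by
  rw [quantize, Function.extend_apply' _ _ _ hc]

theorem binCenter_quantize_secret (hs : ∀ i, 0 < s i) (θ : Param k) {u : Fin d → ℝ} {i : Fin d}
    (hu : u i ∈ Set.Ico 0 (s i)) :
    binCenter (lo i) (s i) (quantize g lo s θ u (g i)) = binCenter (lo i) (s i) (θ (g i)) := by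
  have hbin : binIndex (lo i) (s i) (quantize g lo s θ u (g i))
      = binIndex (lo i) (s i) (θ (g i)) := by
    rw [quantize_secret, binIndex_eq_iff (hs i)]
    exact ⟨by linarith [hu.1], by linarith [hu.2]⟩
  rw [binCenter, hbin, binCenter]

theorem ae_quantMechanism_of_forall {p : Param k → Prop} (hp : MeasurableSet {θ' | p θ'})
    (θ : Param k) (h : ∀ u : Fin d → ℝ, (∀ i, u i ∈ Set.Ico 0 (s i)) → p (quantize g lo s θ u)) :
    ∀ᵐ θ' ∂quantMechanism g lo s θ, p θ' := by
  rw [quantMechanism_apply, ae_map_iff (measurable_quantize_right g lo s θ).aemeasurable hp]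
  have hu : ∀ᵐ u ∂Measure.pi fun i => uniformLaw 0 (s i), ∀ i, u i ∈ Set.Ico 0 (s i) :=
    Filter.eventually_all.2 fun i =>
      Measure.tendsto_eval_ae_ae.eventually (ae_uniformLaw_mem_Ico 0 (s i))
  filter_upwards [hu] using h

theorem map_secrets_eq_pi [IsProbabilityMeasure P] {ν : Fin d → Measure ℝ}
    (hlaw : ∀ i, P.map (fun θ => θ (g i)) = ν i)
    (hindep : iIndepFun (fun (i : Fin d) (θ : Param k) => θ (g i)) P) :
    P.map (fun θ i => θ (g i)) = Measure.pi ν := by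
  rw [(iIndepFun_iff_map_fun_eq_pi_map fun i => Measurable.aemeasurable (by fun_prop)).1 hindep]
  simp_rw [hlaw]

theorem le_interPrivacy_quantMechanism [SFinite P] (hs : ∀ i, 0 < s i) (hε : ∀ i, 2 * ε i ≤ s i)
    (hN : ∀ i, 0 < N i)
    (hlaw : P.map (fun θ i => θ (g i))
      = Measure.pi fun i => uniformLaw (lo i) (lo i + N i * s i)) :
    ∏ i, ENNReal.ofReal (2 * ε i / s i) ≤ interPrivacy P g ε (quantMechanism g lo s) := by
  have := isMarkovKernel_quantMechanism g lo hs
  have hcenters : Measurable fun (θ : Param k) i => binCenter (lo i) (s i) (θ (g i)) :=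
    measurable_pi_lambda _ fun i => (measurable_binCenter _ _).comp (measurable_pi_apply _)
  have hE : MeasurableSet {x : Fin d → ℝ | ∀ i, |binCenter (lo i) (s i) (x i) - x i| ≤ ε i} :=
    (measurableSet_forall_abs_sub_le ε).preimage <| measurable_id.prodMk <|
      measurable_pi_lambda _ fun i => (measurable_binCenter _ _).comp (measurable_pi_apply i)
  refine (le_pi_uniformLaw_setOf_abs_binCenter_sub_le (lo := lo) hs hε hN).trans ?_
  rw [← hlaw, Measure.map_apply (by fun_prop) hE]
  have hsecrets : Measurable fun (θ : Param k) i => θ (g i) := by fun_prop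
  refine measure_le_interPrivacy hcenters (hsecrets hE) (ae_of_all _ fun θ hθ => ?_)
  refine ae_quantMechanism_of_forall ?_ θ fun u hu i => ?_
  · exact (measurable_prodMk_left.comp hcenters) (measurableSet_guess g ε)
  · rw [binCenter_quantize_secret hs θ (hu i)]
    exact hθ i

/-- The parameter with secret coordinates `x` and non-secret coordinates `y`; the outer
`Function.extend` writes `x` over the range of `g`, so the default value `0` of the inner one is
never read. -/
noncomputable def assemble (g : Fin d ↪ Fin k ⊕ Fin k) (x : Fin d → ℝ)
    (y : {j // j ∉ Set.range g} → ℝ) : Param k :=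
  Function.extend g x (Function.extend Subtype.val y 0)

theorem assemble_secret (x : Fin d → ℝ) (y : {j // j ∉ Set.range g} → ℝ) (i : Fin d) :
    assemble g x y (g i) = x i :=
  g.injective.extend_apply _ _ i

theorem assemble_of_notMem_range (x : Fin d → ℝ) (y : {j // j ∉ Set.range g} → ℝ)
    {c : Fin k ⊕ Fin k} (hc : c ∉ Set.range g) : assemble g x y c = y ⟨c, hc⟩ :=
  (Function.extend_apply' _ _ _ hc).trans (Subtype.val_injective.extend_apply y 0 ⟨c, hc⟩)

theorem measurable_assemble (g : Fin d ↪ Fin k ⊕ Fin k) :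
    Measurable fun z : (Fin d → ℝ) × ({j // j ∉ Set.range g} → ℝ) => assemble g z.1 z.2 := by
  refine measurable_pi_iff.2 fun c => ?_
  by_cases hc : c ∈ Set.range g
  · obtain ⟨i, rfl⟩ := hc
    simp only [assemble_secret]
    fun_prop
  · simp only [assemble_of_notMem_range _ _ hc]
    fun_prop

theorem quantize_eq_assemble (θ : Param k) (u : Fin d → ℝ) :
    quantize g lo s θ u
      = assemble g (fun i => lo i + binIndex (lo i) (s i) (θ (g i)) * s i + u i)
          (fun j : {j // j ∉ Set.range g} => θ j) := by
  ext c
  by_cases hc : c ∈ Set.range g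
  · obtain ⟨i, rfl⟩ := hc
    rw [quantize_secret, assemble_secret]
  · rw [quantize_of_notMem_range θ u hc, assemble_of_notMem_range _ _ hc]

theorem lintegral_guess_quantize_le [IsProbabilityMeasure P] (hs : ∀ i, 0 < s i)
    (hlaw : P.map (fun θ i => θ (g i))
      = Measure.pi fun i => uniformLaw (lo i) (lo i + N i * s i))
    (hindep : IndepFun (fun (θ : Param k) (i : Fin d) => θ (g i))
      (fun (θ : Param k) (j : {j // j ∉ Set.range g}) => θ j) P)
    (A : Kernel (Param k) (Fin d → ℝ)) [IsMarkovKernel A] (u : Fin d → ℝ) :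
    ∫⁻ θ, A (quantize g lo s θ u) {a | ∀ i, |a i - θ (g i)| ≤ ε i} ∂P
      ≤ ∏ i, ENNReal.ofReal (2 * ε i / s i) := by
  have hrelease : Measurable fun z : (Fin d → ℝ) × ({j // j ∉ Set.range g} → ℝ) =>
      assemble g (fun i => lo i + binIndex (lo i) (s i) (z.1 i) * s i + u i) z.2 := by
    refine (measurable_assemble g).comp (Measurable.prodMk ?_ measurable_snd)
    simp only [binIndex]
    fun_prop
  have hF : Measurable fun z : (Fin d → ℝ) × ({j // j ∉ Set.range g} → ℝ) =>
      A (assemble g (fun i => lo i + binIndex (lo i) (s i) (z.1 i) * s i + u i) z.2)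
        {a | ∀ i, |a i - z.1 i| ≤ ε i} :=
    Kernel.measurable_kernel_prodMk_left (κ := A.comap _ hrelease)
      ((measurableSet_forall_abs_sub_le ε).preimage
        (f := fun z : ((Fin d → ℝ) × _) × (Fin d → ℝ) => (z.1.1, z.2)) (by fun_prop))
  simp only [quantize_eq_assemble]
  refine lintegral_le_of_indepFun (by fun_prop) (by fun_prop) hindep hF fun y => ?_
  rw [hlaw]
  exact lintegral_guess_pi_uniformLaw_le hs fun n =>
    A (assemble g (fun i => lo i + n i * s i + u i) y)

theorem interPrivacy_quantMechanism_le [IsProbabilityMeasure P] (hs : ∀ i, 0 < s i)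
    (hlaw : P.map (fun θ i => θ (g i))
      = Measure.pi fun i => uniformLaw (lo i) (lo i + N i * s i))
    (hindep : IndepFun (fun (θ : Param k) (i : Fin d) => θ (g i))
      (fun (θ : Param k) (j : {j // j ∉ Set.range g}) => θ j) P) :
    interPrivacy P g ε (quantMechanism g lo s) ≤ ∏ i, ENNReal.ofReal (2 * ε i / s i) := by
  have := fun i => isProbabilityMeasure_uniformLaw (hs i)
  have := isMarkovKernel_quantMechanism g lo hs
  rw [interPrivacy_eq_iSup_lintegral]
  refine iSup₂_le fun A _ => ?_
  have hguess : Measurable fun z : Param k × (Fin d → ℝ) =>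
      A (quantize g lo s z.1 z.2) {a | ∀ i, |a i - z.1 (g i)| ≤ ε i} :=
    Kernel.measurable_kernel_prodMk_left (κ := A.comap _ (measurable_quantize g lo s))
      ((measurableSet_guess g ε).preimage
        (f := fun z : (Param k × (Fin d → ℝ)) × (Fin d → ℝ) => (z.1.1, z.2)) (by fun_prop))
  calc ∫⁻ θ, ∫⁻ θ', A θ' {a | ∀ i, |a i - θ (g i)| ≤ ε i} ∂quantMechanism g lo s θ ∂P
      = ∫⁻ θ, ∫⁻ u, A (quantize g lo s θ u) {a | ∀ i, |a i - θ (g i)| ≤ ε i}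
          ∂(Measure.pi fun i => uniformLaw 0 (s i)) ∂P := by
        refine lintegral_congr fun θ => ?_
        rw [quantMechanism_apply, lintegral_map _ (measurable_quantize_right g lo s θ)]
        exact A.measurable_coe (measurable_prodMk_left (measurableSet_guess g ε))
    _ = ∫⁻ u, ∫⁻ θ, A (quantize g lo s θ u) {a | ∀ i, |a i - θ (g i)| ≤ ε i} ∂P
          ∂(Measure.pi fun i => uniformLaw 0 (s i)) :=
        lintegral_lintegral_swap hguess.aemeasurable
    _ ≤ ∫⁻ _, ∏ i, ENNReal.ofReal (2 * ε i / s i) ∂(Measure.pi fun i => uniformLaw 0 (s i)) :=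
        lintegral_mono (lintegral_guess_quantize_le hs hlaw hindep A)
    _ = ∏ i, ENNReal.ofReal (2 * ε i / s i) := by simp

theorem interPrivacy_quantMechanism [IsProbabilityMeasure P] (hε : ∀ i, 0 ≤ ε i)
    (hs : ∀ i, 0 < s i) (hεs : ∀ i, 2 * ε i ≤ s i) (hN : ∀ i, 0 < N i)
    (hlaw : P.map (fun θ i => θ (g i))
      = Measure.pi fun i => uniformLaw (lo i) (lo i + N i * s i))
    (hindep : IndepFun (fun (θ : Param k) (i : Fin d) => θ (g i))
      (fun (θ : Param k) (j : {j // j ∉ Set.range g}) => θ j) P) :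
    interPrivacy P g ε (quantMechanism g lo s) = ENNReal.ofReal (∏ i, 2 * ε i / s i) := by
  rw [ENNReal.ofReal_prod_of_nonneg fun i _ =>
    div_nonneg (mul_nonneg zero_le_two (hε i)) (hs i).le]
  exact le_antisymm (interPrivacy_quantMechanism_le hs hlaw hindep)
    (le_interPrivacy_quantMechanism hs hεs hN hlaw)

end Privacy

section Distortion

variable {k d : ℕ} {g : Fin d ↪ Fin k ⊕ Fin k} {ε s lo : Fin d → ℝ} {N : Fin d → ℕ}
  {P : Measure (Param k)}

theorem nonneg_of_isRight {θ : Param k} (hσ : ∀ j, 0 ≤ θ (Sum.inr j)) {c : Fin k ⊕ Fin k}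
    (hc : c.isRight) : 0 ≤ θ c := by
  obtain ⟨j, rfl⟩ := Sum.isRight_iff.1 hc
  exact hσ j

theorem wasserstein2_le_distortion {M : Kernel (Param k) (Param k)} {θ θ' : Param k}
    (hθ : θ ∈ P.support) (hθ' : θ' ∈ (M θ).support) :
    wasserstein2 (gaussianLaw θ) (gaussianLaw θ') ≤ distortion P M :=
  le_iSup₂_of_le θ hθ (le_iSup₂_of_le θ' hθ' le_rfl)

theorem ofReal_sqrt_sum_secrets_le_wasserstein2 (g : Fin d ↪ Fin k ⊕ Fin k) (θ θ' : Param k) :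
    ENNReal.ofReal √(∑ i, (absDev θ (g i) - absDev θ' (g i)) ^ 2)
      ≤ wasserstein2 (gaussianLaw θ) (gaussianLaw θ') := by
  rw [wasserstein2_gaussianLaw]
  refine ENNReal.ofReal_le_ofReal (Real.sqrt_le_sqrt ?_)
  rw [← Finset.sum_map Finset.univ g fun c => (absDev θ c - absDev θ' c) ^ 2]
  exact Finset.sum_le_univ_sum_of_nonneg fun c => sq_nonneg _

theorem wasserstein2_quantize_le (hs : ∀ i, 0 < s i) (θ : Param k) {u : Fin d → ℝ}
    (hu : ∀ i, u i ∈ Set.Ico 0 (s i)) :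
    wasserstein2 (gaussianLaw θ) (gaussianLaw (quantize g lo s θ u))
      ≤ ENNReal.ofReal √(∑ i, s i ^ 2) := by
  rw [wasserstein2_gaussianLaw]
  refine ENNReal.ofReal_le_ofReal (Real.sqrt_le_sqrt ?_)
  calc ∑ c, (absDev θ c - absDev (quantize g lo s θ u) c) ^ 2
      ≤ ∑ c, (θ c - quantize g lo s θ u c) ^ 2 :=
        Finset.sum_le_sum fun c _ => sq_le_sq.2 (abs_absDev_sub_le _ _ c)
    _ = ∑ i, (θ (g i) - quantize g lo s θ u (g i)) ^ 2 :=
        (Fintype.sum_of_injective g g.injective _ _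
          (fun c hc => by simp [quantize_of_notMem_range θ u hc]) fun _ => rfl).symm
    _ ≤ ∑ i, s i ^ 2 := by
        refine Finset.sum_le_sum fun i _ => sq_le_sq' ?_ ?_ <;>
        · rw [quantize_secret]
          have hbin := (binIndex_eq_iff (hs i)).1 (rfl : _ = binIndex (lo i) (s i) (θ (g i)))
          linarith [hbin.1, hbin.2, (hu i).1, (hu i).2]

theorem distortion_quantMechanism_le (P : Measure (Param k)) (hs : ∀ i, 0 < s i) :
    distortion P (quantMechanism g lo s) ≤ ENNReal.ofReal √(∑ i, s i ^ 2) := by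
  refine iSup₂_le fun θ _ => iSup₂_le fun θ' hθ' => ?_
  have hclosed : IsClosed {θ' | wasserstein2 (gaussianLaw θ) (gaussianLaw θ')
      ≤ ENNReal.ofReal √(∑ i, s i ^ 2)} :=
    isClosed_le (continuous_wasserstein2_gaussianLaw θ) continuous_const
  exact Measure.support_subset_of_isClosed hclosed
    (ae_quantMechanism_of_forall hclosed.measurableSet θ fun u => wasserstein2_quantize_le hs θ) hθ'

theorem continuous_quantize_right (g : Fin d ↪ Fin k ⊕ Fin k) (lo s : Fin d → ℝ) (θ : Param k) :
    Continuous (quantize g lo s θ) := by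
  refine continuous_pi fun c => ?_
  by_cases hc : c ∈ Set.range g
  · obtain ⟨i, rfl⟩ := hc
    simp only [quantize_secret]
    fun_prop
  · simp only [quantize_of_notMem_range θ _ hc]
    fun_prop

theorem quantize_mem_support_quantMechanism (hs : ∀ i, 0 < s i) (θ : Param k) {u : Fin d → ℝ}
    (hu : ∀ i, u i ∈ Set.Icc 0 (s i)) :
    quantize g lo s θ u ∈ (quantMechanism g lo s θ).support := by
  rw [quantMechanism_apply]
  refine map_mem_support_map (continuous_quantize_right g lo s θ) (mem_support_pi fun i => ?_)
  rw [support_uniformLaw (hs i)]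
  exact hu i

theorem ofReal_sqrt_sum_sub_sq_le_distortion (hs : ∀ i, 0 < s i) {θ : Param k}
    (hθ : θ ∈ P.support) (hσ : ∀ j, 0 ≤ θ (Sum.inr j))
    (hbin : ∀ i, θ (g i) ∈ Set.Ico (lo i) (lo i + s i)) :
    ENNReal.ofReal √(∑ i, (lo i + s i - θ (g i)) ^ 2) ≤ distortion P (quantMechanism g lo s) := by
  refine le_trans ?_ ((ofReal_sqrt_sum_secrets_le_wasserstein2 g _ _).trans
    (wasserstein2_le_distortion hθ (quantize_mem_support_quantMechanism hs θ
      fun i => Set.right_mem_Icc.2 (hs i).le)))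
  refine le_of_eq (congrArg (fun x => ENNReal.ofReal √x) (Finset.sum_congr rfl fun i _ => ?_))
  have hrelease : quantize g lo s θ s (g i) = lo i + s i := by
    rw [quantize_secret, (binIndex_eq_iff (n := 0) (hs i)).2 (by simpa using hbin i)]
    simp
  have hreleaseσ : (g i).isRight → 0 ≤ quantize g lo s θ s (g i) := fun h => by
    rw [hrelease]
    exact (nonneg_of_isRight hσ h).trans (hbin i).2.le
  rw [absDev_apply_of_nonneg (nonneg_of_isRight hσ), absDev_apply_of_nonneg hreleaseσ, hrelease]
  ring

theorem le_distortion_quantMechanism (hs : ∀ i, 0 < s i) (hN : ∀ i, 0 < N i)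
    (hσ : ∀ j, ∀ᵐ θ ∂P, 0 ≤ θ (Sum.inr j))
    (hlaw : P.map (fun θ i => θ (g i))
      = Measure.pi fun i => uniformLaw (lo i) (lo i + N i * s i)) :
    ENNReal.ofReal √(∑ i, s i ^ 2) ≤ distortion P (quantMechanism g lo s) := by
  set D := distortion P (quantMechanism g lo s)
  -- The bound holds for almost every prior sample in the corner bins; closedness of the condition
  -- carries it to `lo`, which lies in the support but is itself a null event.
  have hclosed : IsClosed {x : Fin d → ℝ | (∃ i, lo i + s i ≤ x i) ∨
      ENNReal.ofReal √(∑ i, (lo i + s i - x i) ^ 2) ≤ D} := by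
    simp only [Set.ofPred_or, Set.ofPred_exists]
    exact (isClosed_iUnion_of_finite fun i => isClosed_le (by fun_prop) (by fun_prop)).union
      (isClosed_le (ENNReal.continuous_ofReal.comp (by fun_prop)) continuous_const)
  have hae : ∀ᵐ x ∂Measure.pi fun i => uniformLaw (lo i) (lo i + N i * s i),
      (∃ i, lo i + s i ≤ x i) ∨ ENNReal.ofReal √(∑ i, (lo i + s i - x i) ^ 2) ≤ D := by
    have hlo : ∀ᵐ x ∂Measure.pi fun i => uniformLaw (lo i) (lo i + N i * s i), ∀ i, lo i ≤ x i :=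
      Filter.eventually_all.2 fun i => Measure.tendsto_eval_ae_ae.eventually
        ((ae_uniformLaw_mem_Icc (lo i) (lo i + N i * s i)).mono fun _ h => h.1)
    have hsecrets : Measurable fun (θ : Param k) i => θ (g i) := by fun_prop
    rw [← hlaw] at hlo ⊢
    rw [ae_map_iff hsecrets.aemeasurable hclosed.measurableSet]
    filter_upwards [ae_of_ae_map hsecrets.aemeasurable hlo, Filter.eventually_all.2 hσ,
      Measure.support_mem_ae (μ := P)] with θ hloθ hσθ hθ
    rw [or_iff_not_imp_left, not_exists]
    exact fun hlt => ofReal_sqrt_sum_sub_sq_le_distortion hs hθ hσθ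
      fun i => ⟨hloθ i, not_le.1 (hlt i)⟩
  have hmem : lo ∈ (Measure.pi fun i => uniformLaw (lo i) (lo i + N i * s i)).support := by
    refine mem_support_pi fun i => ?_
    have hlt : lo i < lo i + N i * s i :=
      lt_add_of_pos_right _ (mul_pos (Nat.cast_pos.2 (hN i)) (hs i))
    rw [support_uniformLaw hlt]
    exact Set.left_mem_Icc.2 hlt.le
  rcases Measure.support_subset_of_isClosed hclosed hae hmem with ⟨i, hi⟩ | hD
  · exact absurd hi (not_le.2 (lt_add_of_pos_right _ (hs i)))
  · simpa only [add_sub_cancel_left] using hD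

theorem distortion_quantMechanism (hs : ∀ i, 0 < s i) (hN : ∀ i, 0 < N i)
    (hσ : ∀ j, ∀ᵐ θ ∂P, 0 ≤ θ (Sum.inr j))
    (hlaw : P.map (fun θ i => θ (g i))
      = Measure.pi fun i => uniformLaw (lo i) (lo i + N i * s i)) :
    distortion P (quantMechanism g lo s) = ENNReal.ofReal √(∑ i, s i ^ 2) :=
  le_antisymm (distortion_quantMechanism_le P hs) (le_distortion_quantMechanism hs hN hσ hlaw)

theorem one_le_interPrivacy_of_distortion_lt [IsProbabilityMeasure P]
    (hσ : ∀ j, ∀ᵐ θ ∂P, 0 ≤ θ (Sum.inr j)) {M : Kernel (Param k) (Param k)} [IsMarkovKernel M]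
    {e : ℝ} (he : ∀ i, e ≤ ε i) (hM : distortion P M < ENNReal.ofReal e) :
    1 ≤ interPrivacy P g ε M := by
  have hecho : Measurable fun (θ : Param k) i => absDev θ (g i) :=
    measurable_pi_lambda _ fun i => (measurable_pi_apply (g i)).comp continuous_absDev.measurable
  rw [← measure_univ (μ := P)]
  refine measure_le_interPrivacy hecho MeasurableSet.univ ?_
  filter_upwards [Filter.eventually_all.2 hσ, Measure.support_mem_ae (μ := P)] with θ hσθ hθ _
  filter_upwards [Measure.support_mem_ae (μ := M θ)] with θ' hθ' i
  have hW := (wasserstein2_le_distortion hθ hθ').trans_lt hM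
  rw [wasserstein2_gaussianLaw, ENNReal.ofReal_lt_ofReal_iff_of_nonneg (Real.sqrt_nonneg _)] at hW
  rw [abs_sub_comm, ← absDev_apply_of_nonneg (nonneg_of_isRight hσθ)]
  refine (Real.abs_le_sqrt ?_).trans (hW.le.trans (he i))
  exact Finset.single_le_sum (f := fun c => (absDev θ c - absDev θ' c) ^ 2)
    (fun _ _ => sq_nonneg _) (Finset.mem_univ (g i))

theorem le_optDistortion [IsProbabilityMeasure P] (hσ : ∀ j, ∀ᵐ θ ∂P, 0 ≤ θ (Sum.inr j)) {e : ℝ}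
    (he : ∀ i, e ≤ ε i) {T : ℝ≥0∞} (hT : T < 1) :
    ENNReal.ofReal e ≤ optDistortion P g ε T := by
  refine le_iInf fun M => le_iInf fun _ => le_iInf fun hMT => ?_
  by_contra! hlt
  exact (hMT.trans_lt hT).not_ge (one_le_interPrivacy_of_distortion_lt hσ he hlt)

end Distortion

end SummaryPrivacy

theorem mainTheorem11 {d : ℕ} (ε s : Fin d → ℝ) (hε : ∀ i, 0 < ε i)
    (hs : ∀ i, 2 * ε i ≤ s i) :
    ∃ c : ℝ, 0 < c ∧
      ∀ (k : ℕ) (g : Fin d ↪ Fin k ⊕ Fin k) (lo hi : Fin d → ℝ)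
        (P : Measure (SummaryPrivacy.Param k)),
        -- the bins of length `s i` partition the range of the `i`-th secret
        (∀ i, ∃ N : ℕ, 0 < N ∧ hi i = lo i + N * s i) →
        IsProbabilityMeasure P →
        -- standard deviations are nonnegative
        (∀ j, ∀ᵐ θ ∂P, 0 ≤ θ (Sum.inr j)) →
        -- the secret parameters are uniform, mutually independent,
        -- and independent of the non-secret parameters
        (∀ i, P.map (fun θ => θ (g i)) = SummaryPrivacy.uniformLaw (lo i) (hi i)) →
        iIndepFun (fun (i : Fin d) (θ : SummaryPrivacy.Param k) => θ (g i)) P →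
        IndepFun (fun (θ : SummaryPrivacy.Param k) (i : Fin d) => θ (g i))
          (fun (θ : SummaryPrivacy.Param k) (j : {j // j ∉ Set.range g}) => θ j) P →
        SummaryPrivacy.interPrivacy P g ε (SummaryPrivacy.quantMechanism g lo s)
            = ENNReal.ofReal (∏ i, 2 * ε i / s i) ∧
        SummaryPrivacy.distortion P (SummaryPrivacy.quantMechanism g lo s)
            = ENNReal.ofReal (√(∑ i, s i ^ 2)) ∧
        (∏ i, 2 * ε i / s i < 1 →
          SummaryPrivacy.distortion P (SummaryPrivacy.quantMechanism g lo s)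
            < ENNReal.ofReal c * SummaryPrivacy.optDistortion P g ε
                (SummaryPrivacy.interPrivacy P g ε (SummaryPrivacy.quantMechanism g lo s))) := by
  have hs0 : ∀ i, 0 < s i := fun i => by linarith [hs i, hε i]
  obtain ⟨e, he, heε⟩ := SummaryPrivacy.exists_pos_forall_le hε
  have hc : 0 < √(∑ i, s i ^ 2) / e + 1 := by positivity
  refine ⟨√(∑ i, s i ^ 2) / e + 1, hc, ?_⟩
  intro k g lo hi P hbins _ hσ hunif hindep hindep'
  choose N hN hhi using hbins
  obtain rfl : hi = fun i => lo i + N i * s i := funext hhi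
  have hlaw := SummaryPrivacy.map_secrets_eq_pi hunif hindep
  have hpriv := SummaryPrivacy.interPrivacy_quantMechanism (fun i => (hε i).le) hs0 hs hN hlaw
    hindep'
  have hdist := SummaryPrivacy.distortion_quantMechanism hs0 hN hσ hlaw
  refine ⟨hpriv, hdist, fun hlt => ?_⟩
  rw [hdist, hpriv]
  have hopt := SummaryPrivacy.le_optDistortion (g := g) hσ heε (ENNReal.ofReal_lt_one.2 hlt)
  refine lt_of_lt_of_le ?_ (mul_le_mul_right hopt _)
  rw [← ENNReal.ofReal_mul hc.le, ENNReal.ofReal_lt_ofReal_iff (by positivity), add_mul,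
    div_mul_cancel₀ _ he.ne']
  linarith
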